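/- For a ring $R$ (associative, with identity) and an integer $m>1$, call $R$ strongly $m$-nil clean if every $a\in R$ can be written as $a=e+b$ with $e^m=e$, $b$ nilpotent and $eb=be$. For $r\in R$ put $\mathrm{In}(r)=\min\{k\mid r^k=0\}$ if $r$ is nilpotent and $\mathrm{In}(r)=0$ otherwise, and let $\mathrm{In}(R)=\sup_{r\in R}\mathrm{In}(r)$. Let $J(R)$ denote the Jacobson radical of $R$, and let $\mathrm{E}(G)$ denote the endomorphism ring of an Abelian group $G$. Theorem. Let $m>1$ be a natural number and $G$ an Abelian group. Then the following statements are equivalent: (1) $\mathrm{E}(G)$ is a strongly $m$-nil clean ring; (2) $G$ is a finite group and, for every prime $p$ for which the $p$-primary component $G_p$ of $G$ is nonzero, $(p^i-1)\mid (m-1)$ for every integer $i$ with $1\leq i\leq \mathrm{In}\bigl(\mathrm{E}(G_p)/J(\mathrm{E}(G_p))\bigr)$. -/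

import Mathlib

/-- A ring `R` is strongly `m`-nil clean if every element of `R` is the sum of an `m`-potent
element `e` (that is, `e ^ m = e`) and a nilpotent element `b` which commute with each other. -/
def IsStronglyNilClean (m : ℕ) (R : Type*) [Ring R] : Prop :=
  ∀ a : R, ∃ e b : R, e ^ m = e ∧ IsNilpotent b ∧ Commute e b ∧ a = e + b

/-- The degree of nilpotency `In(R)` of a ring `R`: the supremum over `r : R` of the order of
nilpotency of `r`. Here `nilpotencyClass r` is the least `k` with `r ^ k = 0` if `r` is nilpotent,
and `0` otherwise. The supremum is taken in `ℕ∞`, so it is `⊤` when the orders are unbounded. -/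
noncomputable def nilpotencyDegree (R : Type*) [Ring R] : ℕ∞ :=
  ⨆ r : R, (nilpotencyClass r : ℕ∞)

/-! Strong `m`-nil cleanness forces every `a ^ m - a` to be nilpotent. If some nonzero integer
vanishes in the ring, the converse holds: inside the commutative ring `ℤ[a]` the potent part is
built from high powers of `a` (`exists_potent_of_prime_pow`). So (1) becomes a question of
nilpotency.

On a group of bounded exponent, nilpotency is detected on the Ulm factors, which are `𝔽_p`-spaces
(`isNilpotent_of_forall_ulmMap`). In dimension `d` the eigenvalues lie in fields with `p ^ i`
elements, `i ≤ d`, so the divisibilities give nilpotency. Conversely, `i` independent elements of an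
Ulm factor span a summand `(ℤ/p^(j+1))^i` (`exists_retract_of_linearIndependent`); its endomorphism
ring maps onto the `i × i` matrices over `𝔽_p`, which contain the field with `p ^ i` elements,
whence `p ^ i - 1 ∣ m - 1`.

The same tools show that `In(E(G_p)/J)` is the largest dimension of an Ulm factor of `G_p`: shifts
on summands bound it below, the action on Ulm factors bounds it above. -/

/-! ### Strong nil cleanness and nilpotency of `a ^ m - a` -/

theorem IsStronglyNilClean.isNilpotent_pow_sub_self {m : ℕ} {R : Type*} [Ring R]
    (h : IsStronglyNilClean m R) (a : R) : IsNilpotent (a ^ m - a) := by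
  obtain ⟨e, b, he, hb, hc, rfl⟩ := h a
  have hcomm : Commute (e + b) e := (Commute.refl e).add_left hc.symm
  have hbe : Commute b (e + b) := hc.symm.add_right (Commute.refl b)
  have key := hcomm.mul_geom_sum₂ m
  rw [add_sub_cancel_left, he] at key
  have hS : Commute b (∑ i ∈ Finset.range m, (e + b) ^ i * e ^ (m - 1 - i)) :=
    Commute.sum_right _ _ _ fun i _ => (hbe.pow_right i).mul_right (hc.symm.pow_right _)
  have hsplit : (e + b) ^ m - (e + b) =
      b * (∑ i ∈ Finset.range m, (e + b) ^ i * e ^ (m - 1 - i)) - b := by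
    rw [key]; abel
  rw [hsplit]
  exact Commute.isNilpotent_sub ((Commute.refl b).mul_left hS.symm)
    (hS.isNilpotent_mul_right hb) hb

/-- A nilpotent difference becomes divisible by `p ^ (k + 1)` after raising to `p`-th powers. -/
theorem exists_forall_prime_pow_dvd_pow_sub_pow {S : Type*} [CommRing S] {p : ℕ} (hp : p.Prime)
    {x y : S} (h : IsNilpotent (x - y)) :
    ∃ s, ∀ k, (p : S) ^ (k + 1) ∣ x ^ p ^ (s + k) - y ^ p ^ (s + k) := by
  obtain ⟨s, hs⟩ := h
  refine ⟨s, fun k => ?_⟩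
  have hz : (x - y) ^ p ^ s = 0 := pow_eq_zero_of_le (Nat.lt_pow_self hp.one_lt).le hs
  obtain ⟨r, hr⟩ := exists_add_pow_prime_pow_eq hp (x - y) y s
  rw [sub_add_cancel, hz, zero_add] at hr
  have hd : (p : S) ∣ x ^ p ^ s - y ^ p ^ s := by
    rw [hr, add_sub_cancel_left, mul_assoc, mul_assoc]
    exact dvd_mul_right _ _
  simpa only [pow_add, pow_mul] using dvd_sub_pow_of_dvd_sub hd k

theorem isNilpotent_mul_of_pow_mul_eq_zero {S : Type*} [CommRing S] {p k : ℕ} {ε : S}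
    (hpk : ((p ^ k : ℕ) : S) * ε = 0) (r : S) : IsNilpotent (ε * (p * r)) := by
  refine ⟨k + 1, ?_⟩
  push_cast at hpk
  calc (ε * (p * r)) ^ (k + 1) = (p ^ k * ε) * (ε ^ k * p * r ^ (k + 1)) := by ring
    _ = 0 := by rw [hpk, zero_mul]

/-- Write `m - 1 = p ^ v * M` with `p ∤ M`. The potent part is `ε * a ^ p ^ t`, where `t` is large
enough for `a ^ m ≡ a` to become an equality after raising to the power `p ^ t`, and `p ^ t ≡ 1`
modulo `M`. -/
theorem exists_potent_of_prime_pow {S : Type*} [CommRing S] {m : ℕ} (hm : 1 < m) {a : S}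
    (ha : IsNilpotent (a ^ m - a)) {p k : ℕ} (hp : p.Prime) {ε : S} (hε : IsIdempotentElem ε)
    (hpk : ((p ^ k : ℕ) : S) * ε = 0) :
    ∃ e, ε * e = e ∧ e ^ m = e ∧ IsNilpotent (ε * a - e) := by
  obtain ⟨v, M, hM, hmM⟩ := Nat.exists_eq_pow_mul_and_not_dvd (n := m - 1) (by omega) p hp.ne_one
  have hM0 : 0 < M := Nat.pos_of_ne_zero fun h => hM (h ▸ dvd_zero p)
  obtain ⟨s, hs⟩ := exists_forall_prime_pow_dvd_pow_sub_pow hp ha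
  have hφ : 0 < M.totient := Nat.totient_pos.2 hM0
  set t := M.totient * (s + k) with ht
  have hst : s + k ≤ t := Nat.le_mul_of_pos_left _ hφ
  have hcop : Nat.Coprime p M := (Nat.Prime.coprime_iff_not_dvd hp).2 hM
  have h1 : 1 ≡ p ^ t [MOD M] := by
    have := (Nat.ModEq.pow_totient hcop).pow (s + k)
    rw [one_pow, ← pow_mul] at this
    exact this.symm
  obtain ⟨w, hw⟩ := (Nat.modEq_iff_dvd' (Nat.one_le_pow _ _ hp.pos)).1 h1
  have hw' : p ^ t = M * w + 1 := by have := Nat.one_le_pow t p hp.pos; omega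
  refine ⟨ε * a ^ p ^ t, by rw [← mul_assoc, hε.eq], ?_, ?_⟩
  · obtain ⟨c, hc⟩ := hs (t - s)
    rw [Nat.add_sub_cancel' (by omega)] at hc
    have hzero : ε * ((p : S) ^ (t - s + 1) * c) = 0 := by
      have : t - s + 1 = k + (t - s + 1 - k) := by omega
      rw [this, pow_add]
      push_cast at hpk
      linear_combination (p : S) ^ (t - s + 1 - k) * c * hpk
    have h2 : ε * (a ^ p ^ t) ^ m = ε * a ^ p ^ t := by
      rw [← pow_mul, mul_comm (p ^ t) m, pow_mul]
      rw [← hc] at hzero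
      linear_combination hzero
    rw [mul_pow, hε.pow_eq (by omega), h2]
  -- Modulo `p`, `z ^ p ^ v` equals `a ^ (p ^ v - 1) * (a ^ m - a)`, so `ε * z` is nilpotent; and `a
  -- ^ p ^ t - a = a * (a ^ (M * w) - 1)` is a multiple of `z`.
  · set z := a ^ (M + 1) - a with hz
    have hzn : IsNilpotent (ε * z) := by
      refine IsNilpotent.of_pow (m := p ^ v) ?_
      obtain ⟨r, hr⟩ := exists_add_pow_prime_pow_eq hp z a v
      rw [hz, sub_add_cancel] at hr
      have hv : p ^ v = (p ^ v - 1) + 1 := by have := Nat.one_le_pow v p hp.pos; omega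
      have hexp : (a ^ (M + 1)) ^ p ^ v - a ^ p ^ v = a ^ (p ^ v - 1) * (a ^ m - a) := by
        have e1 : (M + 1) * p ^ v = (p ^ v - 1) + m := by
          have : p ^ v * M + p ^ v = p ^ v - 1 + m := by omega
          linarith
        rw [← pow_mul, e1, mul_sub, ← pow_add, ← pow_succ, ← hv]
      have hsum : (ε * z) ^ p ^ v =
          ε * a ^ (p ^ v - 1) * (a ^ m - a) + ε * (p * (-(z * a * r))) := by
        rw [mul_pow, hε.pow_eq (by positivity [hp.pos] : p ^ v ≠ 0), mul_assoc, ← hexp]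
        linear_combination (-ε) * hr
      rw [hsum]
      exact (Commute.all _ _).isNilpotent_add ((Commute.all _ _).isNilpotent_mul_left ha)
        (isNilpotent_mul_of_pow_mul_eq_zero hpk _)
    obtain ⟨c, hc⟩ := sub_dvd_pow_sub_pow (a ^ M) 1 w
    have : ε * a - ε * a ^ p ^ t = -c * (ε * z) := by
      rw [one_pow, ← pow_mul] at hc
      rw [hw', hz, pow_succ, pow_succ]
      linear_combination (-ε * a) * hc
    rw [this]
    exact (Commute.all _ _).isNilpotent_mul_left hzn

theorem add_pow_of_mul_eq_zero {S : Type*} [CommRing S] {x y : S} (h : x * y = 0) {m : ℕ}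
    (hm : m ≠ 0) : (x + y) ^ m = x ^ m + y ^ m := by
  induction m with
  | zero => exact absurd rfl hm
  | succ m ih =>
    rcases eq_or_ne m 0 with rfl | hm'
    · simp
    · obtain ⟨l, rfl⟩ := Nat.exists_eq_succ_of_ne_zero hm'
      rw [pow_succ, ih hm']
      simp only [Nat.succ_eq_add_one, pow_succ]
      linear_combination (x ^ l + y ^ l) * h

/-- A Bézout relation `u * A + v * B = 1` splits `ε` into orthogonal idempotents killed by `A` and
by `B`, which reduces to prime powers. -/
theorem exists_potent_of_natCast_mul_eq_zero {S : Type*} [CommRing S] {m : ℕ} (hm : 1 < m) {a : S}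
    (ha : IsNilpotent (a ^ m - a)) (N : ℕ) (hN : N ≠ 0) :
    ∀ ε : S, IsIdempotentElem ε → (N : S) * ε = 0 →
      ∃ e, ε * e = e ∧ e ^ m = e ∧ IsNilpotent (ε * a - e) := by
  induction N using Nat.recOnPosPrimePosCoprime with
  | prime_pow p n hp hn => exact fun ε hε h => exists_potent_of_prime_pow hm ha hp hε h
  | zero => exact absurd rfl hN
  | one =>
    intro ε _ h
    rw [Nat.cast_one, one_mul] at h
    exact ⟨0, by simp, by rw [zero_pow (by omega)], by simp [h]⟩
  | coprime A B hA hB hAB ihA ihB =>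
    intro ε hε h
    obtain ⟨u, v, huv⟩ := Int.isCoprime_iff_gcd_eq_one.2 (by simpa using hAB : Int.gcd A B = 1)
    replace huv : (u : S) * A + v * B = 1 := by exact_mod_cast congrArg (Int.cast : ℤ → S) huv
    push_cast at h
    replace hε : ε * ε = ε := hε
    obtain ⟨e, he, hem, hen⟩ := ihA (by omega) (v * B * ε)
      (show _ * _ = _ by linear_combination (v * B) ^ 2 * hε + v * B * ε * huv - v * u * h)
      (by linear_combination v * h)
    obtain ⟨f, hf, hfm, hfn⟩ := ihB (by omega) (u * A * ε)
      (show _ * _ = _ by linear_combination (u * A) ^ 2 * hε + u * A * ε * huv - v * u * h)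
      (by linear_combination u * h)
    have hef : e * f = 0 := by
      rw [← he, ← hf]
      linear_combination v * u * e * f * ε * h
    refine ⟨e + f, ?_, ?_, ?_⟩
    · have h1 : ε * e = e := by rw [← he]; linear_combination v * B * e * hε
      have h2 : ε * f = f := by rw [← hf]; linear_combination u * A * f * hε
      rw [mul_add, h1, h2]
    · rw [add_pow_of_mul_eq_zero hef (by omega), hem, hfm]
    · have : ε * a - (e + f) = (v * B * ε * a - e) + (u * A * ε * a - f) := by
        linear_combination (-ε * a) * huv
      rw [this]
      exact (Commute.all _ _).isNilpotent_add hen hfn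

/-! ### Reduction to `ℤ[a]`, and endomorphisms of `𝔽_p`-spaces -/

section Polynomial

open Polynomial

theorem isStronglyNilClean_of_isNilpotent_pow_sub_self {m : ℕ} (hm : 1 < m) {R : Type*} [Ring R]
    {N : ℕ} (hN : N ≠ 0) (hNR : (N : R) = 0) (h : ∀ a : R, IsNilpotent (a ^ m - a)) :
    IsStronglyNilClean m R := by
  intro a
  let φ : ℤ[X] →+* R := (aeval a).toRingHom
  let ψ := φ.kerLift
  have hψ : Function.Injective ψ := RingHom.kerLift_injective φ
  let x : ℤ[X] ⧸ RingHom.ker φ := Ideal.Quotient.mk _ X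
  have hx : ψ x = a := (RingHom.kerLift_mk φ X).trans (aeval_X a)
  have hxn : IsNilpotent (x ^ m - x) := by
    rw [← IsNilpotent.map_iff hψ, map_sub, map_pow, hx]
    exact h a
  obtain ⟨e, -, he, hn⟩ := exists_potent_of_natCast_mul_eq_zero hm hxn N hN 1
    IsIdempotentElem.one (hψ (by rw [mul_one, map_natCast, hNR, map_zero]))
  refine ⟨ψ e, ψ (1 * x - e), by rw [← map_pow, he], hn.map ψ, ?_, ?_⟩
  · exact (Commute.all e _).map ψ
  · rw [← map_add, ← hx]; congr 1; ring

/-- If `p ^ i - 1` divides `m - 1` for all `i ≤ dim V`, then `f ^ m - f` is nilpotent for every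
endomorphism `f` of an `𝔽_p`-vector space `V`. -/
theorem isNilpotent_pow_sub_self_of_forall_dvd {p : ℕ} [Fact p.Prime] {V : Type*} [AddCommGroup V]
    [Module (ZMod p) V] [Module.Finite (ZMod p) V] {m : ℕ} (hm : 1 < m)
    (h : ∀ i, 1 ≤ i → i ≤ Module.finrank (ZMod p) V → p ^ i - 1 ∣ m - 1)
    (f : Module.End (ZMod p) V) : IsNilpotent (f ^ m - f) := by
  set χ := f.charpoly with hχ
  have hprime : ∀ g : (ZMod p)[X], Prime g → g ∣ χ → g ∣ X ^ m - X := by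
    intro g hg hgχ
    have hirr := hg.irreducible
    have : Fact (Irreducible g) := ⟨hirr⟩
    have hg0 : g ≠ 0 := hg.ne_zero
    have hfin : Module.finrank (ZMod p) (AdjoinRoot g) = g.natDegree :=
      (AdjoinRoot.powerBasis hg0).finrank.trans (AdjoinRoot.powerBasis_dim hg0)
    have : Module.Finite (ZMod p) (AdjoinRoot g) := (AdjoinRoot.powerBasis hg0).finite
    have : Finite (AdjoinRoot g) := Module.finite_of_finite (ZMod p)
    have := Fintype.ofFinite (AdjoinRoot g)
    have hcard : Fintype.card (AdjoinRoot g) = p ^ g.natDegree := by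
      rw [Module.card_eq_pow_finrank (K := ZMod p), ZMod.card, hfin]
    have hdeg : g.natDegree ≤ Module.finrank (ZMod p) V := by
      rw [← f.charpoly_natDegree]
      exact natDegree_le_of_dvd hgχ f.charpoly_monic.ne_zero
    obtain ⟨c, hc⟩ := h g.natDegree hirr.natDegree_pos hdeg
    -- The root lies in a field with `p ^ deg g` elements, and `p ^ deg g - 1 ∣ m - 1`.
    have hroot : (AdjoinRoot.root g) ^ m = AdjoinRoot.root g := by
      rcases eq_or_ne (AdjoinRoot.root g) 0 with h0 | h0
      · rw [h0, zero_pow (by omega)]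
      · have h1 := FiniteField.pow_card_sub_one_eq_one _ h0
        rw [hcard] at h1
        have : m = m - 1 + 1 := by omega
        rw [this, pow_succ, hc, pow_mul, h1, one_pow, one_mul]
    rw [← AdjoinRoot.mk_eq_zero, map_sub, map_pow, AdjoinRoot.mk_X, hroot, sub_self]
  have hdvd : ∃ n, χ ∣ (X ^ m - X) ^ n := by
    -- Every prime ideal containing `χ` is generated by a prime factor of `χ`, hence contains `X ^ m
    -- - X`.
    have key : IsNilpotent (Ideal.Quotient.mk (Ideal.span {χ}) (X ^ m - X)) := by
      rw [nilpotent_iff_mem_prime]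
      intro J hJ
      have hJ' := Ideal.comap_isPrime (Ideal.Quotient.mk (Ideal.span {χ})) J
      have hχJ : χ ∈ J.comap (Ideal.Quotient.mk (Ideal.span {χ})) := by
        rw [Ideal.mem_comap, Ideal.Quotient.eq_zero_iff_mem.2 (Ideal.mem_span_singleton_self χ)]
        exact J.zero_mem
      obtain ⟨g, hg⟩ := IsPrincipalIdealRing.principal
        (J.comap (Ideal.Quotient.mk (Ideal.span {χ})))
      change _ = Ideal.span {g} at hg
      rw [hg] at hJ' hχJ
      rw [Ideal.mem_span_singleton] at hχJ
      have hg0 : g ≠ 0 := by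
        rintro rfl
        exact f.charpoly_monic.ne_zero (zero_dvd_iff.1 hχJ)
      have := hprime g ((Ideal.span_singleton_prime hg0).1 hJ') hχJ
      rw [← Ideal.mem_span_singleton, ← hg] at this
      exact this
    obtain ⟨n, hn⟩ := key
    rw [← map_pow, Ideal.Quotient.eq_zero_iff_mem, Ideal.mem_span_singleton] at hn
    exact ⟨n, hn⟩
  obtain ⟨n, q, hq⟩ := hdvd
  refine ⟨n, ?_⟩
  have := congrArg (aeval f) hq
  rwa [map_mul, hχ, f.aeval_self_charpoly, zero_mul, map_pow, map_sub, map_pow, aeval_X] at this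

theorem IsNilpotent.pow_finrank_eq_zero {K V : Type*} [Field K] [AddCommGroup V] [Module K V]
    [Module.Finite K V] {f : Module.End K V} (hf : IsNilpotent f) :
    f ^ Module.finrank K V = 0 := by
  have := f.aeval_self_charpoly
  rwa [(LinearMap.isNilpotent_iff_charpoly f).1 hf, map_pow, aeval_X] at this

end Polynomial

/-! ### Self-injectivity of `ℤ/n`, and direct summands -/

/-- Baer's criterion: an ideal is generated by some `d` with `n = d * c`. The image `b` of `d`
satisfies `c * b = 0`, so `d ∣ b` and the map is multiplication by `b / d`. -/
theorem ZMod.exists_linearMap_comp_eq (n : ℕ) [NeZero n] {M N : Type*} [AddCommGroup M]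
    [AddCommGroup N] [Module (ZMod n) M] [Module (ZMod n) N] (f : M →ₗ[ZMod n] N)
    (hf : Function.Injective f) (g : M →ₗ[ZMod n] ZMod n) : ∃ h, h ∘ₗ f = g := by
  refine Module.Baer.extension_property ?_ f hf g
  intro I g
  obtain ⟨d, hd⟩ := IsPrincipalIdealRing.principal (I.comap (Int.castRingHom (ZMod n)))
  change _ = Ideal.span {d} at hd
  have hmem : ∀ z : ℤ, (z : ZMod n) ∈ I ↔ d ∣ z := fun z => by
    rw [← Ideal.mem_span_singleton, ← hd]; rfl
  have hdI : (d : ZMod n) ∈ I := (hmem d).2 dvd_rfl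
  obtain ⟨c, hc⟩ : d ∣ (n : ℤ) := (hmem n).1 (by simp)
  have hc0 : c ≠ 0 := by
    rintro rfl
    exact NeZero.ne n (by simpa using hc)
  obtain ⟨b, hb⟩ := ZMod.intCast_surjective (g ⟨d, hdI⟩)
  have hcb : ((c * b : ℤ) : ZMod n) = 0 := by
    have h0 : (c : ZMod n) • (⟨d, hdI⟩ : I) = 0 := by
      ext
      change (c : ZMod n) * (d : ZMod n) = 0
      rw [mul_comm, ← Int.cast_mul, ← hc]
      simp
    rw [Int.cast_mul, hb, ← smul_eq_mul, ← map_smul, h0, map_zero]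
  rw [ZMod.intCast_zmod_eq_zero_iff_dvd, hc, mul_comm d c] at hcb
  obtain ⟨b', rfl⟩ := (mul_dvd_mul_iff_left hc0).1 hcb
  refine ⟨LinearMap.mulRight (ZMod n) (b' : ZMod n), fun x hx => ?_⟩
  obtain ⟨z, rfl⟩ := ZMod.intCast_surjective x
  obtain ⟨w, rfl⟩ := (hmem z).1 hx
  have hsm : (⟨((d * w : ℤ) : ZMod n), hx⟩ : I) = (w : ZMod n) • ⟨d, hdI⟩ := by
    ext
    simp [mul_comm]
  rw [hsm, map_smul, ← hb, LinearMap.mulRight_apply, smul_eq_mul]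
  push_cast
  ring

section Intertwining

variable {G H : Type*} [AddCommGroup G] [AddCommGroup H]

theorem AddMonoid.End.pow_apply_of_intertwining {ι : H →+ G} {a : AddMonoid.End G}
    {f : AddMonoid.End H} (h : ∀ x, a (ι x) = ι (f x)) (k : ℕ) (x : H) :
    (a ^ k) (ι x) = ι ((f ^ k) x) := by
  induction k generalizing x with
  | zero => rfl
  | succ k ih =>
    rw [pow_succ, pow_succ]
    change (a ^ k) (a (ι x)) = _
    rw [h, ih]
    rfl

/-- The property that all `f ^ m - f` are nilpotent passes to the endomorphism ring of a direct
summand. -/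
theorem isNilpotent_pow_sub_self_of_retract {m : ℕ}
    (hG : ∀ a : AddMonoid.End G, IsNilpotent (a ^ m - a)) {ι : H →+ G} {π : G →+ H}
    (hπ : ∀ x, π (ι x) = x) (f : AddMonoid.End H) : IsNilpotent (f ^ m - f) := by
  let a : AddMonoid.End G := (ι.comp f).comp π
  have ha : ∀ x, a (ι x) = ι (f x) := fun x => congrArg (fun y => ι (f y)) (hπ x)
  have hsub : ∀ x, (a ^ m - a) (ι x) = ι ((f ^ m - f) x) := fun x => by
    change (a ^ m) (ι x) - a (ι x) = ι ((f ^ m) x - f x)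
    rw [map_sub, AddMonoid.End.pow_apply_of_intertwining ha, ha]
  obtain ⟨s, hs⟩ := hG a
  refine ⟨s, AddMonoidHom.ext fun x => ?_⟩
  have := AddMonoid.End.pow_apply_of_intertwining hsub s x
  rw [hs] at this
  exact (hπ _).symm.trans ((congrArg π this.symm).trans (map_zero π))

end Intertwining

/-- If `f ^ m - f` is nilpotent for all endomorphisms `f` of `(ℤ/p^j)^n`, then `p ^ n - 1` divides
`m - 1`. -/
theorem prime_pow_sub_one_dvd {p j n m : ℕ} (hp : p.Prime) (hj : j ≠ 0) (hn : n ≠ 0) (hm : 1 < m)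
    (h : ∀ f : AddMonoid.End (Fin n → ZMod (p ^ j)), IsNilpotent (f ^ m - f)) :
    p ^ n - 1 ∣ m - 1 := by
  have : Fact p.Prime := ⟨hp⟩
  let ρ : Matrix (Fin n) (Fin n) (ZMod (p ^ j)) →+* Matrix (Fin n) (Fin n) (ZMod p) :=
    (ZMod.castHom (dvd_pow_self p hj) (ZMod p)).mapMatrix
  have hmat : ∀ A : Matrix (Fin n) (Fin n) (ZMod p), IsNilpotent (A ^ m - A) := by
    intro A
    obtain ⟨B, rfl⟩ : ∃ B, ρ B = A := by
      choose c hc using fun i k => ZMod.castHom_surjective (dvd_pow_self p hj) (A i k)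
      exact ⟨Matrix.of c, by ext i k; exact hc i k⟩
    rw [← map_pow, ← map_sub]
    refine IsNilpotent.map ?_ ρ
    let τ : Matrix (Fin n) (Fin n) (ZMod (p ^ j)) →+* AddMonoid.End (Fin n → ZMod (p ^ j)) :=
      (Module.toAddMonoidEnd (Module.End (ZMod (p ^ j)) (Fin n → ZMod (p ^ j))) _).comp
        (Matrix.toLinAlgEquiv' : _ ≃ₐ[ZMod (p ^ j)] _).toRingEquiv.toRingHom
    have hτ : Function.Injective τ := by
      intro A B hAB
      refine Matrix.toLinAlgEquiv'.injective (LinearMap.ext fun x => ?_)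
      exact DFunLike.congr_fun hAB x
    rw [← IsNilpotent.map_iff hτ, map_sub, map_pow]
    exact h _
  let F := GaloisField p n
  have : Fintype F := Fintype.ofFinite F
  have hF : Module.finrank (ZMod p) F = n := GaloisField.finrank p hn
  let b : Module.Basis (Fin n) (ZMod p) F := Module.finBasisOfFinrankEq (ZMod p) F hF
  -- In the field `F`, embedded in the matrices, nilpotency of `ζ ^ m - ζ` means `ζ ^ m = ζ`, and
  -- `ζ` has order `p ^ n - 1`.
  obtain ⟨ζ, hζ⟩ := IsCyclic.exists_generator (α := Fˣ)
  have hnil : IsNilpotent ((ζ : F) ^ m - ζ) := by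
    rw [← IsNilpotent.map_iff (Algebra.leftMulMatrix_injective b), map_sub, map_pow]
    exact hmat _
  have hζm : ζ ^ (m - 1) = 1 := by
    have h1 := sub_eq_zero.1 hnil.eq_zero
    ext
    have h2 : (ζ : F) * (ζ : F) ^ (m - 1) = ζ * 1 := by
      rw [← pow_succ', Nat.sub_add_cancel hm.le, h1, mul_one]
    simpa using mul_left_cancel₀ ζ.ne_zero h2
  have hord := orderOf_dvd_of_pow_eq_one hζm
  rwa [orderOf_eq_card_of_forall_mem_zpowers hζ, Nat.card_units, GaloisField.card p n hn] at hord

/-! ### Ulm factors and the action of endomorphisms -/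

section Ulm

variable (G : Type*) [AddCommGroup G] (p j : ℕ)

/-- The subgroup `p ^ j G ∩ G[p]` of the `p`-socle `G[p]`. -/
def socleFiltration : AddSubgroup G where
  carrier := {x | p • x = 0 ∧ ∃ y, p ^ j • y = x}
  zero_mem' := ⟨smul_zero _, 0, smul_zero _⟩
  add_mem' := by
    rintro _ _ ⟨hx, x, rfl⟩ ⟨hy, y, rfl⟩
    exact ⟨by rw [smul_add, hx, hy, add_zero], x + y, smul_add _ _ _⟩
  neg_mem' := by
    rintro _ ⟨hx, x, rfl⟩
    exact ⟨by rw [smul_neg, hx, neg_zero], -x, smul_neg _ _⟩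

/-- The quotient `(p ^ j G ∩ G[p]) / (p ^ (j + 1) G ∩ G[p])`, whose dimension over `𝔽_p` is the
`j`-th Ulm–Kaplansky invariant of `G`. -/
def UlmFactor : Type _ :=
  socleFiltration G p j ⧸ (socleFiltration G p (j + 1)).addSubgroupOf (socleFiltration G p j)

noncomputable instance : AddCommGroup (UlmFactor G p j) :=
  inferInstanceAs (AddCommGroup (socleFiltration G p j ⧸
    (socleFiltration G p (j + 1)).addSubgroupOf (socleFiltration G p j)))

/-- The projection onto the Ulm factor. -/
noncomputable def UlmFactor.mk : socleFiltration G p j →+ UlmFactor G p j :=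
  QuotientAddGroup.mk' _

variable {G p j}

theorem UlmFactor.mk_surjective : Function.Surjective (UlmFactor.mk G p j) :=
  QuotientAddGroup.mk'_surjective _

theorem UlmFactor.mk_eq_zero {x : socleFiltration G p j} :
    UlmFactor.mk G p j x = 0 ↔ (x : G) ∈ socleFiltration G p (j + 1) :=
  (QuotientAddGroup.eq_zero_iff x).trans AddSubgroup.mem_addSubgroupOf

variable (G p j) in
noncomputable instance : Module (ZMod p) (UlmFactor G p j) :=
  AddCommGroup.zmodModule fun x => by
    obtain ⟨x, rfl⟩ := UlmFactor.mk_surjective x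
    rw [← map_nsmul]
    have : p • x = 0 := Subtype.ext x.2.1
    rw [this, map_zero]

theorem map_mem_socleFiltration (a : AddMonoid.End G) {x : G} (hx : x ∈ socleFiltration G p j) :
    a x ∈ socleFiltration G p j := by
  obtain ⟨hx, y, rfl⟩ := hx
  exact ⟨by rw [← map_nsmul, hx, map_zero], a y, (map_nsmul a _ _).symm⟩

variable (G p j) in
/-- The action of the endomorphism ring on an Ulm factor. -/
noncomputable def ulmMap : AddMonoid.End G →+* Module.End (ZMod p) (UlmFactor G p j) where
  toFun a := AddMonoidHom.toZModLinearMap p (QuotientAddGroup.map _ _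
    ((a.comp (socleFiltration G p j).subtype).codRestrict (socleFiltration G p j)
      fun x => map_mem_socleFiltration a x.2)
    fun x hx => map_mem_socleFiltration (j := j + 1) a (x := (x : G)) hx :
      UlmFactor G p j →+ UlmFactor G p j)
  map_one' := by
    ext x
    obtain ⟨x, rfl⟩ := UlmFactor.mk_surjective x
    rfl
  map_mul' a b := by
    ext x
    obtain ⟨x, rfl⟩ := UlmFactor.mk_surjective x
    rfl
  map_zero' := by
    ext x
    obtain ⟨x, rfl⟩ := UlmFactor.mk_surjective x
    rfl
  map_add' a b := by
    ext x
    obtain ⟨x, rfl⟩ := UlmFactor.mk_surjective x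
    rfl

theorem ulmMap_mk (a : AddMonoid.End G) (x : socleFiltration G p j) :
    ulmMap G p j a (UlmFactor.mk G p j x) =
      UlmFactor.mk G p j ⟨a x, map_mem_socleFiltration a x.2⟩ :=
  rfl

theorem map_mem_of_ulmMap_eq_zero {a : AddMonoid.End G} (ha : ulmMap G p j a = 0) {x : G}
    (hx : x ∈ socleFiltration G p j) : a x ∈ socleFiltration G p (j + 1) := by
  have := ulmMap_mk a ⟨x, hx⟩
  rw [ha, LinearMap.zero_apply, eq_comm, UlmFactor.mk_eq_zero] at this
  exact this

/-- If `x = p ^ j • y`, the order of `y` is a power `p ^ t ≤ N`, so `t < N ≤ j`. -/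
theorem eq_zero_of_mem_socleFiltration (hp : p.Prime) {N : ℕ} (hN : N ≠ 0)
    (hG : ∀ g : G, N • g = 0) (hj : N ≤ j) {x : G} (hx : x ∈ socleFiltration G p j) : x = 0 := by
  obtain ⟨hx, y, rfl⟩ := hx
  rw [← mul_nsmul', ← pow_succ'] at hx
  have hd := Nat.dvd_gcd (addOrderOf_dvd_of_nsmul_eq_zero hx)
    (addOrderOf_dvd_of_nsmul_eq_zero (hG y))
  obtain ⟨t, -, ht⟩ := (Nat.dvd_prime_pow hp).1 (hd.trans (Nat.gcd_dvd_left _ _))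
  have htN : p ^ t ≤ N := ht ▸ Nat.le_of_dvd (by omega) (hd.trans (Nat.gcd_dvd_right _ _))
  have : t < p ^ t := Nat.lt_pow_self hp.one_lt
  rw [← addOrderOf_dvd_iff_nsmul_eq_zero, ht]
  exact pow_dvd_pow p (by omega)

/-- A power of `a` vanishing on an Ulm factor moves the socle filtration one step down, and the
filtration is finite, so a power of `a` kills each socle. Induction on the prime factors of `N`
passes from socles to `G`. -/
theorem isNilpotent_of_forall_ulmMap {N : ℕ} (hN : N ≠ 0) (hG : ∀ g : G, N • g = 0)
    {a : AddMonoid.End G} (ha : ∀ p j, p.Prime → IsNilpotent (ulmMap G p j a)) :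
    IsNilpotent a := by
  have hsocle : ∀ p : ℕ, p.Prime → ∃ s, ∀ x : G, p • x = 0 → (a ^ s) x = 0 := by
    intro p hp
    have key : ∀ d j, N ≤ j + d → ∃ s, ∀ x ∈ socleFiltration G p j, (a ^ s) x = 0 := by
      intro d
      induction d with
      | zero => exact fun j hj => ⟨0, fun x hx => eq_zero_of_mem_socleFiltration hp hN hG hj hx⟩
      | succ d ih =>
        intro j hj
        obtain ⟨s, hs⟩ := ih (j + 1) (by omega)
        obtain ⟨t, ht⟩ := ha p j hp
        rw [← map_pow] at ht
        refine ⟨s + t, fun x hx => ?_⟩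
        rw [pow_add]
        exact hs _ (map_mem_of_ulmMap_eq_zero ht hx)
    obtain ⟨s, hs⟩ := key N 0 (by omega)
    exact ⟨s, fun x hx => hs x ⟨hx, x, by rw [pow_zero, one_smul]⟩⟩
  have key : ∀ M : ℕ, M ≠ 0 → ∃ s, ∀ x : G, M • x = 0 → (a ^ s) x = 0 := by
    intro M
    induction M using induction_on_primes with
    | zero => exact fun h => absurd rfl h
    | one => exact fun _ => ⟨0, fun x hx => by rwa [one_smul] at hx⟩
    | prime_mul p M hp ih =>
      intro hM
      obtain ⟨s, hs⟩ := ih (right_ne_zero_of_mul hM)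
      obtain ⟨t, ht⟩ := hsocle p hp
      refine ⟨s + t, fun x hx => ?_⟩
      rw [pow_add]
      refine hs ((a ^ t) x) ?_
      rw [← map_nsmul]
      exact ht _ (by rwa [← mul_nsmul'])
  obtain ⟨s, hs⟩ := key N hN
  exact ⟨s, AddMonoidHom.ext fun x => hs x (hG x)⟩

theorem finite_of_finite_ulmFactor {N : ℕ} (hN : N ≠ 0) (hG : ∀ g : G, N • g = 0)
    (h : ∀ p j, p.Prime → Finite (UlmFactor G p j)) : Finite G := by
  have hsocle : ∀ p : ℕ, p.Prime → {x : G | p • x = 0}.Finite := by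
    intro p hp
    have key : ∀ d j, N ≤ j + d → Finite (socleFiltration G p j) := by
      intro d
      induction d with
      | zero =>
        intro j hj
        have : Subsingleton (socleFiltration G p j) := ⟨fun x y => Subtype.ext <| by
          rw [eq_zero_of_mem_socleFiltration hp hN hG hj x.2,
            eq_zero_of_mem_socleFiltration hp hN hG hj y.2]⟩
        infer_instance
      | succ d ih =>
        intro j hj
        have := ih (j + 1) (by omega)
        have hq : Finite (socleFiltration G p j ⧸
          (socleFiltration G p (j + 1)).addSubgroupOf (socleFiltration G p j)) := h p j hp
        have hs : Finite ((socleFiltration G p (j + 1)).addSubgroupOf (socleFiltration G p j)) :=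
          Finite.of_injective (β := socleFiltration G p (j + 1)) (fun x => ⟨x.1, x.2⟩)
            fun x y hxy => Subtype.ext <| Subtype.ext <|
            congrArg (fun z : socleFiltration G p (j + 1) => (z : G)) hxy
        exact Finite.of_equiv _ (AddSubgroup.addGroupEquivQuotientProdAddSubgroup
          (s := (socleFiltration G p (j + 1)).addSubgroupOf (socleFiltration G p j))).symm
    have := key N 0 (by omega)
    exact (Set.toFinite (socleFiltration G p 0 : Set G)).subset fun x hx => ⟨hx, x, by rw [pow_zero, one_smul]⟩
  have key : ∀ M : ℕ, M ≠ 0 → {x : G | M • x = 0}.Finite := by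
    intro M
    induction M using induction_on_primes with
    | zero => exact fun h => absurd rfl h
    | one => exact fun _ => by simp
    | prime_mul p M hp ih =>
      intro hM
      -- Multiplication by `M` sends `G[p * M]` into the finite socle `G[p]`, and its nonempty
      -- fibres are translates of `G[M]`.
      refine ((hsocle p hp).preimage' (f := fun x => M • x) fun y _ => ?_).subset fun x hx => ?_
      · rcases (((fun x : G => M • x) ⁻¹' {y}).eq_empty_or_nonempty) with h0 | ⟨x₀, hx₀⟩
        · rw [h0]; exact Set.finite_empty
        · refine ((ih (right_ne_zero_of_mul hM)).image (x₀ + ·)).subset fun x hx => ?_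
          refine ⟨x - x₀, ?_, add_sub_cancel _ _⟩
          change M • (x - x₀) = 0
          rw [smul_sub, show M • x = y from hx, show M • x₀ = y from hx₀, sub_self]
      · change p • (M • x) = 0
        rw [← mul_nsmul']
        exact hx
  exact Set.finite_univ_iff.1 ((key N hN).subset fun x _ => hG x)

/-- `n` independent elements of the `j`-th Ulm factor give a direct summand `(ℤ/p^(j+1))^n`. -/
theorem exists_retract_of_linearIndependent [Fact p.Prime] {n : ℕ} {v : Fin n → UlmFactor G p j}
    (hv : LinearIndependent (ZMod p) v) :
    ∃ (ι : (Fin n → ZMod (p ^ (j + 1))) →+ G) (π : G →+ (Fin n → ZMod (p ^ (j + 1)))),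
      ∀ x, π (ι x) = x := by
  have hp : p.Prime := Fact.out
  choose y hy using fun l => UlmFactor.mk_surjective (v l)
  choose x hx using fun l => (y l).2.2
  have hx0 : ∀ l, zmultiplesHom G (x l) ((p ^ (j + 1) : ℕ) : ℤ) = 0 := fun l => by
    rw [zmultiplesHom_apply, natCast_zsmul, pow_succ', mul_nsmul', hx]
    exact (y l).2.1
  let ι : (Fin n → ZMod (p ^ (j + 1))) →+ G :=
    ∑ l, (ZMod.lift (p ^ (j + 1)) ⟨zmultiplesHom G (x l), hx0 l⟩).comp (Pi.evalAddMonoidHom _ l)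
  have hι : ∀ z : Fin n → ℤ, ι (fun l => (z l : ZMod (p ^ (j + 1)))) = ∑ l, z l • x l := by
    intro z
    simp [ι, AddMonoidHom.finsetSum_apply]
  -- `G` need not be a `ℤ/p^(j+1)`-module, but `Q = G / p^(j+1) G` is. If the map stays injective
  -- into `Q`, self-injectivity of `ℤ/p^(j+1)` extends the coordinate functions to `Q`.
  obtain ⟨Q, _, _, mkQ, hmk⟩ : ∃ (Q : Type _) (_ : AddCommGroup Q)
      (_ : Module (ZMod (p ^ (j + 1))) Q) (mkQ : G →+ Q),
      ∀ g, mkQ g = 0 ↔ ∃ h : G, p ^ (j + 1) • h = g :=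
    ⟨G ⧸ (nsmulAddMonoidHom (α := G) (p ^ (j + 1))).range, inferInstance,
      QuotientAddGroup.zmodModule fun g => ⟨g, rfl⟩, QuotientAddGroup.mk' _,
      fun g => QuotientAddGroup.eq_zero_iff g⟩
  let ι' := (mkQ.comp ι).toZModLinearMap (p ^ (j + 1))
  have hinj : Function.Injective ι' := by
    rw [injective_iff_map_eq_zero]
    intro u hu
    choose z hz using fun l => ZMod.intCast_surjective (u l)
    obtain rfl : (fun l => (z l : ZMod (p ^ (j + 1)))) = u := funext hz
    obtain ⟨g, hg⟩ := (hmk _).1 hu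
    rw [hι] at hg
    -- If `z = p ^ s * w`, multiplying the relation by `p ^ (j - s)` puts `∑ w l • y l` in `p ^ (j +
    -- 1) G`; independence in the Ulm factor then gives `p ∣ w l`.
    have hdvd : ∀ s ≤ j + 1, ∀ l, ((p ^ s : ℕ) : ℤ) ∣ z l := by
      intro s
      induction s with
      | zero => simp
      | succ s ih =>
        intro hs
        choose w hw using ih (by omega)
        have hsum : ∑ l, w l • (y l : G) = p ^ (j + 1) • (p ^ (j - s) • g) := by
          rw [smul_comm, hg, Finset.smul_sum]
          refine Finset.sum_congr rfl fun l _ => ?_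
          rw [← hx, hw, ← natCast_zsmul, ← natCast_zsmul, smul_smul, smul_smul]
          congr 1
          have : j = (j - s) + s := by omega
          conv_lhs => rw [this]
          push_cast
          ring
        have hmem : UlmFactor.mk G p j (∑ l, w l • y l) = 0 := by
          rw [UlmFactor.mk_eq_zero]
          have hco : ((∑ l, w l • y l : socleFiltration G p j) : G) = ∑ l, w l • (y l : G) := by
            simp
          exact ⟨(∑ l, w l • y l : socleFiltration G p j).2.1, p ^ (j - s) • g,
            by rw [hco, hsum]⟩
        rw [map_sum] at hmem
        have hcomb : ∑ l, (w l : ZMod p) • v l = 0 := by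
          rw [← hmem]
          refine Finset.sum_congr rfl fun l _ => ?_
          rw [map_zsmul, hy, Int.cast_smul_eq_zsmul]
        intro l
        have := Fintype.linearIndependent_iff.1 hv _ hcomb l
        rw [ZMod.intCast_zmod_eq_zero_iff_dvd] at this
        rw [hw, pow_succ]
        push_cast
        exact mul_dvd_mul_left _ this
    funext l
    exact (ZMod.intCast_zmod_eq_zero_iff_dvd _ _).2 (hdvd (j + 1) le_rfl l)
  choose π hπ using fun l =>
    ZMod.exists_linearMap_comp_eq (p ^ (j + 1)) ι' hinj (LinearMap.proj l)
  refine ⟨ι, AddMonoidHom.comp (AddMonoidHom.mk' (fun q l => π l q)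
    fun q r => funext fun l => map_add (π l) q r) mkQ, fun u => funext fun l => ?_⟩
  exact DFunLike.congr_fun (hπ l) u

end Ulm

/-! ### The Jacobson radical and the nilpotency degree -/

theorem Ring.mem_jacobson_iff {R : Type*} [Ring R] {x : R} :
    x ∈ Ring.jacobson R ↔ ∀ y, ∃ z, z * (y * x + 1) = 1 := by
  rw [← Ideal.jacobson_bot, Ideal.mem_jacobson_iff]
  refine forall_congr' fun y => exists_congr fun z => ?_
  rw [Ideal.mem_bot, sub_eq_zero, mul_add, mul_one, mul_assoc]

/-- Finiteness gives `x ^ a = x ^ b` with `a < b`; then `1 - x ^ (b - a)` is left invertible and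
kills `x ^ a`. -/
theorem Ring.isNilpotent_of_mem_jacobson {R : Type*} [Ring R] [Finite R] {x : R}
    (hx : x ∈ Ring.jacobson R) : IsNilpotent x := by
  obtain ⟨a, b, hab, h⟩ := Finite.exists_ne_map_eq_of_infinite (fun k : ℕ => x ^ k)
  wlog hlt : a < b generalizing a b
  · exact this b a hab.symm h.symm (by omega)
  obtain ⟨z, hz⟩ := Ring.mem_jacobson_iff.1 hx (-x ^ (b - a - 1))
  refine ⟨a, ?_⟩
  have hb : x ^ b = x ^ (b - a - 1) * x * x ^ a := by
    rw [← pow_succ, ← pow_add]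
    congr 1
    omega
  have h0 : (-x ^ (b - a - 1) * x + 1) * x ^ a = 0 := by
    rw [add_mul, neg_mul, neg_mul, ← hb, one_mul, ← h, neg_add_cancel]
  rw [← one_mul (x ^ a), ← hz, mul_assoc, h0, mul_zero]

section NilpotencyDegree

variable {G : Type*} [AddCommGroup G]

/-- The left shift on `R ^ n`. -/
def shiftEnd (n : ℕ) (R : Type*) [AddCommGroup R] : AddMonoid.End (Fin n → R) where
  toFun v i := if h : i + 1 < n then v ⟨i + 1, h⟩ else 0
  map_zero' := by ext; simp
  map_add' v w := by
    ext i
    by_cases h : i + 1 < n <;> simp [h]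

theorem shiftEnd_pow_apply {n : ℕ} {R : Type*} [AddCommGroup R] (k : ℕ) (v : Fin n → R)
    (i : Fin n) : (shiftEnd n R ^ k) v i = if h : i + k < n then v ⟨i + k, h⟩ else 0 := by
  induction k generalizing v with
  | zero =>
    change v i = _
    simp
  | succ k ih =>
    rw [pow_succ]
    change (shiftEnd n R ^ k) (shiftEnd n R v) i = _
    rw [ih]
    by_cases h : i + (k + 1) < n
    · rw [dif_pos h, dif_pos (by omega)]
      exact dif_pos (by simpa [add_assoc] using h)
    · rw [dif_neg h]
      split_ifs with h'
      · exact dif_neg (by simpa [add_assoc] using h)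
      · rfl

theorem le_nilpotencyDegree_of_retract {n : ℕ} {R : Type*} [Ring R] [Nontrivial R]
    {ι : (Fin n → R) →+ G} {π : G →+ (Fin n → R)} (hπ : ∀ x, π (ι x) = x) :
    (n : ℕ∞) ≤ nilpotencyDegree (AddMonoid.End G ⧸ Ring.jacobson (AddMonoid.End G)) := by
  rcases Nat.eq_zero_or_pos n with rfl | hn
  · simp
  let r : AddMonoid.End G := (ι.comp (shiftEnd n R)).comp π
  have hr : ∀ x, r (ι x) = ι (shiftEnd n R x) := fun x =>
    congrArg (fun y => ι (shiftEnd n R y)) (hπ x)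
  have hrn : r ^ (n + 1) = 0 := by
    refine AddMonoidHom.ext fun g => ?_
    rw [pow_succ]
    change (r ^ n) (ι (shiftEnd n R (π g))) = 0
    rw [AddMonoid.End.pow_apply_of_intertwining hr]
    have : (shiftEnd n R ^ n) (shiftEnd n R (π g)) = 0 := by
      ext i
      rw [shiftEnd_pow_apply, dif_neg (by omega)]
      rfl
    rw [this, map_zero]
  let mk := Ideal.Quotient.mk (Ring.jacobson (AddMonoid.End G))
  have hnil : IsNilpotent (mk r) := ⟨n + 1, by rw [← map_pow, hrn, map_zero]⟩
  refine le_trans ?_ (le_iSup (fun x => (nilpotencyClass x : ℕ∞)) (mk r))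
  rw [Nat.cast_le]
  by_contra! hlt
  have hmem : r ^ (n - 1) ∈ Ring.jacobson (AddMonoid.End G) := by
    have h0 := pow_nilpotencyClass hnil
    rw [← map_pow, Ideal.Quotient.eq_zero_iff_mem] at h0
    have : n - 1 = (n - 1 - nilpotencyClass (mk r)) + nilpotencyClass (mk r) := by omega
    rw [this, pow_add]
    exact Ideal.mul_mem_left _ _ h0
  -- `r ^ (n - 1)` carries the last coordinate to the first and `σ` carries it back, so `1 - s * r ^
  -- (n - 1)` kills `ι w`. It would be left invertible if `r ^ (n - 1)` were in the radical.
  let σ : AddMonoid.End (Fin n → R) :=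
    (AddMonoidHom.single (fun _ : Fin n => R) ⟨n - 1, by omega⟩).comp
      (Pi.evalAddMonoidHom _ ⟨0, hn⟩)
  let s : AddMonoid.End G := (ι.comp σ).comp π
  let w : Fin n → R := Pi.single ⟨n - 1, by omega⟩ 1
  have hfix : (s * r ^ (n - 1)) (ι w) = ι w := by
    change s ((r ^ (n - 1)) (ι w)) = ι w
    rw [AddMonoid.End.pow_apply_of_intertwining hr]
    change ι (σ (π (ι _))) = _
    rw [hπ]
    congr 1
    change (Pi.single _ ((shiftEnd n R ^ (n - 1)) w ⟨0, hn⟩) : Fin n → R) = _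
    rw [shiftEnd_pow_apply, dif_pos (by simp; omega)]
    simp [w]
  obtain ⟨z, hz⟩ := Ring.mem_jacobson_iff.1 hmem (-s)
  have hιw : ι w = 0 := by
    have h1 : (z * (-s * r ^ (n - 1) + 1)) (ι w) = ι w := by rw [hz]; rfl
    rw [neg_mul] at h1
    change z (-((s * r ^ (n - 1)) (ι w)) + ι w) = ι w at h1
    rw [hfix, neg_add_cancel, map_zero] at h1
    exact h1.symm
  have hw0 : w = 0 := by rw [← hπ w, hιw, map_zero]
  have := congrFun hw0 ⟨n - 1, by omega⟩
  simp [w] at this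

instance [Finite G] (p j : ℕ) : Finite (UlmFactor G p j) :=
  Finite.of_surjective _ UlmFactor.mk_surjective

/-- An element nilpotent modulo the radical is nilpotent, so its `d`-th power acts as zero on every
Ulm factor. Left multiples of that power are then nilpotent, which puts it in the radical. -/
theorem nilpotencyDegree_le_of_finrank_le [Finite G] {d : ℕ}
    (h : ∀ p j, p.Prime → Module.finrank (ZMod p) (UlmFactor G p j) ≤ d) :
    nilpotencyDegree (AddMonoid.End G ⧸ Ring.jacobson (AddMonoid.End G)) ≤ d := by
  have : Finite (AddMonoid.End G) := DFunLike.finite _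
  refine iSup_le fun r => ?_
  obtain ⟨r, rfl⟩ := Ideal.Quotient.mk_surjective r
  rw [Nat.cast_le]
  by_cases hr : IsNilpotent (Ideal.Quotient.mk (Ring.jacobson (AddMonoid.End G)) r)
  swap
  · exact (Nat.eq_zero_of_not_pos fun h0 => hr (isNilpotent_of_pos_nilpotencyClass h0)).trans_le
      (Nat.zero_le d)
  obtain ⟨k, hk⟩ := hr
  rw [← map_pow, Ideal.Quotient.eq_zero_iff_mem] at hk
  have hr : IsNilpotent r := (Ring.isNilpotent_of_mem_jacobson hk).of_pow
  have hzero : ∀ p j, p.Prime → ulmMap G p j (r ^ d) = 0 := by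
    intro p j hp
    have : Fact p.Prime := ⟨hp⟩
    rw [map_pow]
    exact pow_eq_zero_of_le (h p j hp) (hr.map (ulmMap G p j)).pow_finrank_eq_zero
  refine Nat.sInf_le ?_
  change _ ^ d = 0
  rw [← map_pow, Ideal.Quotient.eq_zero_iff_mem, Ring.mem_jacobson_iff]
  intro y
  have hnil : IsNilpotent (y * r ^ d) :=
    isNilpotent_of_forall_ulmMap (Nat.card_pos (α := G)).ne' (fun _ => card_nsmul_eq_zero')
      fun p j hp => by
        rw [map_mul, hzero p j hp, mul_zero]
        exact IsNilpotent.zero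
  obtain ⟨u, hu⟩ := hnil.isUnit_add_one
  exact ⟨↑u⁻¹, by rw [← hu, Units.inv_mul]⟩

end NilpotencyDegree

/-! ### Primary components, finiteness and the equivalence -/

/-- The primary components of a finite group are direct summands. -/
theorem AddCommGroup.exists_retract_primaryComponent (G : Type*) [AddCommGroup G] [Finite G]
    {p : ℕ} (hp : p.Prime) :
    ∃ π : G →+ primaryComponent G p, ∀ x, π ((primaryComponent G p).subtype x) = x := by
  obtain ⟨v, M, hM, hcard⟩ := Nat.exists_eq_pow_mul_and_not_dvd
    (Nat.card_pos (α := G)).ne' p hp.ne_one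
  have hcop : (p ^ v).Coprime M := Nat.Coprime.pow_left v ((Nat.Prime.coprime_iff_not_dvd hp).2 hM)
  obtain ⟨u, hu1, hu0⟩ := Nat.chineseRemainder hcop 1 0
  obtain ⟨c, rfl⟩ := (Nat.modEq_zero_iff_dvd).1 hu0
  refine ⟨(nsmulAddMonoidHom (M * c)).codRestrict _ fun g => ⟨v, ?_⟩, fun x => Subtype.ext ?_⟩
  · change p ^ v • ((M * c) • g) = 0
    rw [← mul_nsmul', ← mul_assoc, ← hcard, mul_nsmul, card_nsmul_eq_zero', smul_zero]
  · change (M * c) • (x : G) = x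
    obtain ⟨k, hk⟩ := x.2
    have hd : addOrderOf (x : G) ∣ p ^ v := by
      obtain ⟨t, -, ht⟩ := (Nat.dvd_prime_pow hp).1 (addOrderOf_dvd_of_nsmul_eq_zero hk)
      have hdc : addOrderOf (x : G) ∣ p ^ v * M := hcard ▸ addOrderOf_dvd_natCard (x : G)
      rw [ht] at hdc ⊢
      exact Nat.Coprime.dvd_of_dvd_mul_right
        (Nat.Coprime.pow_left t ((Nat.Prime.coprime_iff_not_dvd hp).2 hM)) hdc
    have := (nsmul_eq_nsmul_iff_modEq (x := (x : G))).2 (hu1.of_dvd hd)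
    rwa [one_smul] at this

theorem exists_linearIndependent_of_infinite {p : ℕ} [Fact p.Prime] {V : Type*} [AddCommGroup V]
    [Module (ZMod p) V] [Infinite V] (n : ℕ) : ∃ v : Fin n → V, LinearIndependent (ZMod p) v := by
  have hV : ¬ Module.Finite (ZMod p) V := fun h =>
    not_finite_iff_infinite.2 ‹Infinite V› (Module.finite_of_finite (ZMod p))
  rw [← Module.rank_lt_aleph0_iff, not_lt] at hV
  obtain ⟨s, rfl, hs⟩ := le_rank_iff_exists_linearIndependent_finset.1
    ((Cardinal.natCast_lt_aleph0 (n := n)).le.trans hV)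
  exact ⟨_, hs.comp _ s.equivFin.symm.injective⟩

/-- Applied to the endomorphism `2`, nilpotency bounds the exponent of `G`. An infinite Ulm factor
would contain `m` independent elements, forcing `p ^ m - 1 ∣ m - 1`, which is too large. -/
theorem IsStronglyNilClean.finite {m : ℕ} (hm : 1 < m) {G : Type*} [AddCommGroup G]
    (h : IsStronglyNilClean m (AddMonoid.End G)) : Finite G := by
  have hnil := h.isNilpotent_pow_sub_self
  obtain ⟨s, hs⟩ := hnil 2
  have h2 : 2 < 2 ^ m := by simpa using Nat.pow_lt_pow_right (a := 2) (by omega) hm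
  have hN : (2 ^ m - 2) ^ s ≠ 0 := pow_ne_zero _ (by omega)
  have hcast : (((2 ^ m - 2) ^ s : ℕ) : AddMonoid.End G) = 0 := by
    rw [Nat.cast_pow, Nat.cast_sub h2.le]
    push_cast
    exact hs
  refine finite_of_finite_ulmFactor hN (fun g => DFunLike.congr_fun hcast g) fun p j hp => ?_
  by_contra hinf
  rw [not_finite_iff_infinite] at hinf
  have : Fact p.Prime := ⟨hp⟩
  obtain ⟨v, hv⟩ := exists_linearIndependent_of_infinite (p := p) (V := UlmFactor G p j) m
  obtain ⟨ι, π, hπ⟩ := exists_retract_of_linearIndependent hv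
  have hdvd := prime_pow_sub_one_dvd hp j.succ_ne_zero (by omega) hm
    (isNilpotent_pow_sub_self_of_retract hnil hπ)
  have hle := Nat.le_of_dvd (by omega) hdvd
  have : m < p ^ m := Nat.lt_pow_self hp.one_lt
  omega

theorem mainTheorem2 (m : ℕ) (hm : 1 < m) (G : Type*) [AddCommGroup G] :
    IsStronglyNilClean m (AddMonoid.End G) ↔
      Finite G ∧
        ∀ p : ℕ, p.Prime → Nontrivial (AddCommGroup.primaryComponent G p) →
          ∀ i : ℕ, 1 ≤ i →
            (i : ℕ∞) ≤ nilpotencyDegree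
              (AddMonoid.End (AddCommGroup.primaryComponent G p) ⧸
                Ring.jacobson (AddMonoid.End (AddCommGroup.primaryComponent G p))) →
            (p ^ i - 1) ∣ (m - 1) := by
  constructor
  · intro h
    have hfin : Finite G := h.finite hm
    refine ⟨hfin, fun p hp _ i hi hle => ?_⟩
    obtain ⟨ρ, hρ⟩ := AddCommGroup.exists_retract_primaryComponent G hp
    have hnil := isNilpotent_pow_sub_self_of_retract h.isNilpotent_pow_sub_self hρ
    obtain ⟨q, j, hq, hqj⟩ : ∃ q j, q.Prime ∧
        i ≤ Module.finrank (ZMod q) (UlmFactor (AddCommGroup.primaryComponent G p) q j) := by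
      by_contra! hlt
      have := hle.trans (nilpotencyDegree_le_of_finrank_le (d := i - 1)
        fun q j hq => Nat.le_sub_one_of_lt (hlt q j hq))
      rw [Nat.cast_le] at this
      omega
    have : Fact q.Prime := ⟨hq⟩
    obtain ⟨v, hv⟩ := exists_linearIndependent_of_le_finrank hqj
    obtain ⟨ι, π, hπ⟩ := exists_retract_of_linearIndependent hv
    have hdvd := prime_pow_sub_one_dvd hq j.succ_ne_zero (by omega) hm
      (isNilpotent_pow_sub_self_of_retract hnil hπ)
    -- The bound on the nilpotency degree ranges over all primes `q`, but a `p`-primary group has no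
    -- nonzero element killed by `q ≠ p`.
    suffices hpq : q = p by rwa [hpq] at hdvd
    by_contra hne
    have hx : v ⟨0, hi⟩ ≠ 0 := hv.ne_zero _
    obtain ⟨y, hy⟩ := UlmFactor.mk_surjective (v ⟨0, hi⟩)
    obtain ⟨k, hk⟩ := (y : AddCommGroup.primaryComponent G p).2
    have hy1 : q • (y : AddCommGroup.primaryComponent G p) = 0 := y.2.1
    have hy2 : p ^ k • (y : AddCommGroup.primaryComponent G p) = 0 := Subtype.ext hk
    have hd := Nat.dvd_gcd (addOrderOf_dvd_of_nsmul_eq_zero hy1)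
      (addOrderOf_dvd_of_nsmul_eq_zero hy2)
    rw [Nat.Coprime.pow_right k ((Nat.coprime_primes hq hp).2 hne), Nat.dvd_one,
      AddMonoid.addOrderOf_eq_one_iff] at hd
    have hy0 : y = 0 := Subtype.ext hd
    rw [← hy, hy0, map_zero] at hx
    exact hx rfl
  · rintro ⟨hfin, h⟩
    have hcard : Nat.card G ≠ 0 := (Nat.card_pos (α := G)).ne'
    have hkill : ∀ g : G, Nat.card G • g = 0 := fun _ => card_nsmul_eq_zero'
    refine isStronglyNilClean_of_isNilpotent_pow_sub_self hm hcard
      (AddMonoidHom.ext hkill) fun a => ?_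
    refine isNilpotent_of_forall_ulmMap hcard hkill fun p j hp => ?_
    have : Fact p.Prime := ⟨hp⟩
    rw [map_sub, map_pow]
    refine isNilpotent_pow_sub_self_of_forall_dvd hm (fun i hi hle => ?_) _
    obtain ⟨v, hv⟩ := exists_linearIndependent_of_le_finrank hle
    obtain ⟨ι, π, hπ⟩ := exists_retract_of_linearIndependent hv
    -- The summand `(ℤ/p^(j+1))^i` is `p`-primary, so it is a summand of `G_p` and makes the
    -- nilpotency degree at least `i`.
    have hmem : ∀ x, ι x ∈ AddCommGroup.primaryComponent G p := fun x => ⟨j + 1, by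
      rw [← map_nsmul]
      have : p ^ (j + 1) • x = 0 := by
        ext l
        simp [nsmul_eq_mul]
      rw [this, map_zero]⟩
    let ι' := ι.codRestrict (AddCommGroup.primaryComponent G p) hmem
    let π' := π.comp (AddCommGroup.primaryComponent G p).subtype
    have hπ' : ∀ x, π' (ι' x) = x := hπ
    have : Fact (1 < p ^ (j + 1)) := ⟨Nat.one_lt_pow j.succ_ne_zero hp.one_lt⟩
    have : Nonempty (Fin i) := ⟨⟨0, hi⟩⟩
    exact h p hp (Function.LeftInverse.injective hπ').nontrivial i hi
      (le_nilpotencyDegree_of_retract hπ')
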